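/- A \emph{zonotope} is a Minkowski sum of finitely many line segments in $\mathbb{R}^d$. The \emph{faces} of a polytope $P\subset\mathbb{R}^d$ are the nonempty sets of maximizers over $P$ of linear functionals (so $P$ is a face of itself); a \emph{$k$-face} is a face of dimension $k$, $0$-faces are vertices and $1$-faces are edges. $P$ is \emph{vertex-transitive} if the isometries of $\mathbb{R}^d$ that map $P$ onto itself act transitively on the vertices of $P$. $P$ is \emph{homogeneous} if all its vertices lie on a common sphere (of radius $\ge 0$) and all its edges have the same length. Let $Z\subset\mathbb{R}^d$, $d \ge 0$, be a zonotope. Then: (i) If $Z$ is vertex-transitive, then every face of $Z$ is vertex-transitive. (ii) If $Z$ is homogeneous, then $Z$ is vertex-transitive. (iii) If all $2$-faces of $Z$ are homogeneous, then $Z$ is homogeneous; if all $2$-faces of $Z$ are vertex-transitive, then $Z$ is vertex-transitive. In particular, the same holds if all faces of $Z$ are homogeneous (respectively vertex-transitive). -/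

import Mathlib

open scoped Pointwise

namespace Zonotopes

/-- A zonotope in `ℝ^d`: a Minkowski sum of finitely many line segments. Segments may degenerate
to points, so single points are zonotopes and every translate of a zonotope is a zonotope. -/
def IsZonotope {d : ℕ} (Z : Set (EuclideanSpace ℝ (Fin d))) : Prop :=
  ∃ (n : ℕ) (a b : Fin n → EuclideanSpace ℝ (Fin d)), Z = ∑ i, segment ℝ (a i) (b i)

/-- `F` is a (nonempty) face of `P`: the set of maximizers over `P` of a linear functional. The zero
functional yields `P` itself as a face. -/
def IsFace {d : ℕ} (P F : Set (EuclideanSpace ℝ (Fin d))) : Prop :=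
  F.Nonempty ∧ IsExposed ℝ P F

/-- `F` is a `k`-face of `P`: a face whose affine hull has dimension `k`. -/
def IsFaceOfDim {d : ℕ} (k : ℕ) (P F : Set (EuclideanSpace ℝ (Fin d))) : Prop :=
  IsFace P F ∧ Module.finrank ℝ (vectorSpan ℝ F) = k

/-- The vertices of `P`: the points that form a face on their own. -/
def vertices {d : ℕ} (P : Set (EuclideanSpace ℝ (Fin d))) : Set (EuclideanSpace ℝ (Fin d)) :=
  {v | IsFace P {v}}

/-- `P` is vertex-transitive: the Euclidean isometries of `ℝ^d` that map `P` onto itself act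
transitively on the vertices of `P`. -/
def VertexTransitive {d : ℕ} (P : Set (EuclideanSpace ℝ (Fin d))) : Prop :=
  ∀ v ∈ vertices P, ∀ w ∈ vertices P,
    ∃ T : EuclideanSpace ℝ (Fin d) ≃ᵃⁱ[ℝ] EuclideanSpace ℝ (Fin d), T '' P = P ∧ T v = w

/-- `P` is homogeneous: all vertices are on a common sphere and all edges (that is, 1-faces) have
the same length. The length of an edge, which is a line segment, is its diameter. -/
def Homogeneous {d : ℕ} (P : Set (EuclideanSpace ℝ (Fin d))) : Prop :=
  (∃ (c : EuclideanSpace ℝ (Fin d)) (ρ : ℝ), vertices P ⊆ Metric.sphere c ρ) ∧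
    ∃ ℓ : ℝ, ∀ e, IsFaceOfDim 1 P e → Metric.diam e = ℓ

end Zonotopes

/-! Merging parallel segments writes the zonotope as `zono c S` with `S` finite, symmetric and
reduced, each pair `±x` contributing the segment from `-x` to `x`. Vertices correspond to chambers
of the arrangement of hyperplanes orthogonal to the elements of `S`. Crossing the wall of `x`
changes the vertex by `2x`, and faces are translates of zonotopes of subsystems `face S y`.

Everything is compared with one property, `ReflClosed S`: the system is stable under its own
reflections. It passes to faces, and it can be tested on 2-faces because it involves only two
vectors at a time (`reflClosed_of_face`).

A closed system is transitive, since reflection in a wall exchanges the two chambers beside it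
(`ReflClosed.transitive`). Conversely, suppose that the vertices lie on a sphere and the generators
have equal norms. On planar faces this describes an inscribed equilateral polygon, which is
symmetric under reflections along its edges (`reflClosed_of_finrank_eq_two`), so `S` is closed.

If `S` is only transitive, its lengths may differ. Normalizing the generators keeps chambers and
symmetries, so the unit system is inscribed and equilateral, hence closed: the directions of `S` are
permuted. Since `S` is inscribed too, its vertices determine the lengths, and the reflections
preserve these as well (`ScaledReflClosed.reflClosed`). -/

namespace Zonotopes

/-! ### Chambers and walls of the hyperplane arrangement of `S`. -/

section Arrangement

open Filter Topology

variable {V : Type*} [NormedAddCommGroup V] [InnerProductSpace ℝ V]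

/-- A finite centrally symmetric set of nonzero vectors that contains at most two vectors on every
line. -/
structure Reduced (S : Finset V) : Prop where
  zero_notMem : (0 : V) ∉ S
  neg_mem : ∀ x ∈ S, -x ∈ S
  parallel : ∀ x ∈ S, ∀ t : ℝ, t • x ∈ S → t = 1 ∨ t = -1

/-- A vector that is not orthogonal to any element of `S`. -/
def Generic (S : Finset V) (y : V) : Prop := ∀ x ∈ S, inner ℝ y x ≠ 0

/-- The sum of those elements of `S` that have positive inner product with `y`. -/
noncomputable def vert (S : Finset V) (y : V) : V :=
  ∑ x ∈ S, if 0 < inner ℝ y x then x else 0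

/-- `y` and `y'` lie in adjacent chambers of the hyperplane arrangement defined by `S`, and `x ∈ S`
is the normal vector, on the side of `y`, of the wall that separates them. -/
structure IsWall (S : Finset V) (y y' x : V) : Prop where
  mem : x ∈ S
  pos : 0 < inner ℝ y x
  neg : inner ℝ y' x < 0
  other : ∀ z ∈ S, z ≠ x → z ≠ -x → 0 < inner ℝ y z * inner ℝ y' z

/-- All the vectors `vert S y`, for generic `y`, have the same norm. -/
def Inscribed (S : Finset V) : Prop := ∃ ρ : ℝ, ∀ y, Generic S y → ‖vert S y‖ = ρ

theorem Reduced.ne_zero {S : Finset V} (hS : Reduced S) {x : V} (hx : x ∈ S) : x ≠ 0 :=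
  fun h => hS.zero_notMem (h ▸ hx)

theorem Reduced.norm_pos {S : Finset V} (hS : Reduced S) {x : V} (hx : x ∈ S) : 0 < ‖x‖ :=
  norm_pos_iff.2 (hS.ne_zero hx)

theorem Reduced.filter {S : Finset V} (hS : Reduced S) (p : V → Prop) [DecidablePred p]
    (hp : ∀ x, p x → p (-x)) : Reduced (S.filter p) where
  zero_notMem h := hS.zero_notMem (Finset.mem_filter.1 h).1
  neg_mem x hx := by
    rw [Finset.mem_filter] at hx ⊢
    exact ⟨hS.neg_mem x hx.1, hp x hx.2⟩
  parallel x hx t ht := hS.parallel x (Finset.mem_filter.1 hx).1 t (Finset.mem_filter.1 ht).1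

/-- A small perturbation of `y` does not change the nonzero signs. -/
theorem exists_perturb (S : Finset V) (y w : V) :
    ∃ ε : ℝ, 0 < ε ∧ ∀ x ∈ S, inner ℝ y x ≠ 0 → 0 < inner ℝ y x * inner ℝ (y + ε • w) x := by
  have h : ∀ᶠ ε : ℝ in 𝓝[>] 0, ∀ x ∈ S, inner ℝ y x ≠ 0 →
      0 < inner ℝ y x * inner ℝ (y + ε • w) x := by
    rw [Filter.eventually_all_finset]
    intro x _
    by_cases hx : inner ℝ y x = 0
    · exact Eventually.of_forall fun _ h => absurd hx h
    have hc : ContinuousAt (fun ε : ℝ => inner ℝ y x * inner ℝ (y + ε • w) x) 0 := by fun_prop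
    have := hc.eventually_const_lt (u := 0) (by
      simpa using mul_self_pos.2 hx)
    filter_upwards [nhdsWithin_le_nhds this] with ε hε _ using hε
  obtain ⟨ε, h1, h2⟩ := (h.and self_mem_nhdsWithin).exists
  exact ⟨ε, h2, h1⟩

/-- Finitely many hyperplanes do not cover `Uᗮ`: a vanishing inner product is repaired by a
perturbation too small to spoil the earlier ones. -/
theorem exists_mem_orthogonal_generic [FiniteDimensional ℝ V] (U : Submodule ℝ V) (S : Finset V)
    (hS : ∀ x ∈ S, x ∉ U) : ∃ y ∈ Uᗮ, Generic S y := by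
  classical
  induction S using Finset.induction_on with
  | empty => exact ⟨0, zero_mem _, fun x hx => absurd hx (Finset.notMem_empty x)⟩
  | insert a S _ ih =>
    obtain ⟨y, hyU, hy⟩ := ih fun x hx => hS x (Finset.mem_insert_of_mem hx)
    by_cases ha : inner ℝ y a = 0
    · have haU : a ∉ Uᗮᗮ := by
        rw [Submodule.orthogonal_orthogonal]
        exact hS a (Finset.mem_insert_self a S)
      rw [Submodule.mem_orthogonal] at haU
      push Not at haU
      obtain ⟨w, hwU, hw⟩ := haU
      obtain ⟨ε, hε, h⟩ := exists_perturb S y w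
      refine ⟨y + ε • w, add_mem hyU (Submodule.smul_mem _ _ hwU), fun x hx => ?_⟩
      rcases Finset.mem_insert.1 hx with rfl | hx
      · rw [inner_add_left, ha, zero_add, real_inner_smul_left]
        exact mul_ne_zero hε.ne' hw
      · exact right_ne_zero_of_mul (h x hx (hy x hx)).ne'
    · refine ⟨y, hyU, fun x hx => ?_⟩
      rcases Finset.mem_insert.1 hx with rfl | hx
      · exact ha
      · exact hy x hx

theorem exists_generic_same_sign [FiniteDimensional ℝ V] {S : Finset V} {z : V} (hz : Generic S z)
    (B : Finset V) (hB : (0 : V) ∉ B) :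
    ∃ z', Generic B z' ∧ ∀ x ∈ S, 0 < inner ℝ z x * inner ℝ z' x := by
  classical
  obtain ⟨w, -, hw⟩ := exists_mem_orthogonal_generic (⊥ : Submodule ℝ V) B
    fun x hx h => hB ((Submodule.mem_bot ℝ).1 h ▸ hx)
  obtain ⟨ε, hε, h⟩ := exists_perturb (S ∪ B) z w
  refine ⟨z + ε • w, fun x hx => ?_, fun x hx => h x (Finset.mem_union_left _ hx) (hz x hx)⟩
  by_cases hzx : inner ℝ z x = 0
  · rw [inner_add_left, hzx, zero_add, real_inner_smul_left]
    exact mul_ne_zero hε.ne' (hw x hx)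
  · exact right_ne_zero_of_mul (h x (Finset.mem_union_right _ hx) hzx).ne'

namespace IsWall

variable {S : Finset V} {y y' x : V}

theorem generic_left (h : IsWall S y y' x) : Generic S y := by
  intro z hz
  by_cases h1 : z = x
  · exact h1 ▸ h.pos.ne'
  by_cases h2 : z = -x
  · rw [h2, inner_neg_right]
    exact neg_ne_zero.2 h.pos.ne'
  exact left_ne_zero_of_mul (h.other z hz h1 h2).ne'

theorem generic_right (h : IsWall S y y' x) : Generic S y' := by
  intro z hz
  by_cases h1 : z = x
  · exact h1 ▸ h.neg.ne
  by_cases h2 : z = -x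
  · rw [h2, inner_neg_right]
    exact neg_ne_zero.2 h.neg.ne
  exact right_ne_zero_of_mul (h.other z hz h1 h2).ne'

/-- Only two signs change at the wall: `x` leaves the sum and `-x` enters it. -/
theorem vert_eq (h : IsWall S y y' x) (hS : Reduced S) :
    vert S y' = vert S y - (2 : ℝ) • x := by
  have hne : x ≠ -x := fun h' => by
    have h1 := congrArg (fun u => inner ℝ y u) h'
    simp only [inner_neg_right] at h1
    linarith [h.pos]
  have : vert S y - vert S y' = (2 : ℝ) • x := by
    rw [vert, vert, ← Finset.sum_sub_distrib, Finset.sum_eq_add_of_mem x (-x) h.mem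
      (hS.neg_mem x h.mem) hne]
    · have h1 := h.pos
      have h2 := h.neg
      simp only [inner_neg_right, Left.neg_pos_iff, h1, h2, not_lt.2 h1.le, not_lt.2 h2.le, if_true,
        if_false, two_smul]
      abel
    · intro z hz ⟨h1, h2⟩
      simp only [pos_iff_pos_of_mul_pos (h.other z hz h1 h2), sub_self]
  rw [← this]
  abel

end IsWall

theorem vert_congr {S : Finset V} {y z : V} (h : ∀ x ∈ S, 0 < inner ℝ y x * inner ℝ z x) :
    vert S y = vert S z :=
  Finset.sum_congr rfl fun x hx => by simp only [pos_iff_pos_of_mul_pos (h x hx)]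

theorem Generic.neg {S : Finset V} {y : V} (h : Generic S y) : Generic S (-y) := fun x hx => by
  rw [inner_neg_left]
  exact neg_ne_zero.2 (h x hx)

/-- From a chamber one can cross a wall in direction of any other chamber. -/
theorem exists_isWall [FiniteDimensional ℝ V] {S : Finset V} (hS : Reduced S) {y z : V}
    (hy : Generic S y) (hz : Generic S z) {x₀ : V} (hx₀ : x₀ ∈ S) (h₁ : 0 < inner ℝ y x₀)
    (h₂ : inner ℝ z x₀ < 0) : ∃ x y', IsWall S y y' x ∧ inner ℝ z x < 0 := by
  classical
  -- The ray `y + τ • z'` meets the hyperplane of `x` at `τ = ⟪y, x⟫ / -⟪z', x⟫`. Moving `z` to `z'`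
  -- within its chamber rules out that two different hyperplanes are met at the same `τ`.
  obtain ⟨z', hz'B, hz'⟩ := exists_generic_same_sign hz
    (((S ×ˢ S).filter fun p => p.2 ≠ p.1 ∧ p.2 ≠ -p.1).image fun p =>
      inner ℝ y p.1 • p.2 - inner ℝ y p.2 • p.1) (by
    intro h
    obtain ⟨⟨a, b⟩, hab, h⟩ := Finset.mem_image.1 h
    simp only [Finset.mem_filter, Finset.mem_product] at hab h
    obtain ⟨⟨ha, hb⟩, h1, h2⟩ := hab
    have hba : b = (inner ℝ y b / inner ℝ y a) • a := by
      rw [div_eq_inv_mul, mul_smul, ← sub_eq_zero.1 h, smul_smul, inv_mul_cancel₀ (hy a ha),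
        one_smul]
    rcases hS.parallel a ha _ (hba ▸ hb) with h3 | h3 <;> rw [h3] at hba
    · exact h1 (by simpa using hba)
    · exact h2 (by simpa using hba))
  set D := S.filter fun x => 0 < inner ℝ y x ∧ inner ℝ z' x < 0 with hD
  have hDne : D.Nonempty := ⟨x₀, by
    rw [hD, Finset.mem_filter]
    exact ⟨hx₀, h₁, by nlinarith [hz' x₀ hx₀]⟩⟩
  obtain ⟨x, hxD, hx⟩ := D.exists_min_image (fun x => inner ℝ y x / -inner ℝ z' x) hDne
  obtain ⟨hxS, hxy, hxz⟩ := Finset.mem_filter.1 hxD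
  have hlt : ∀ w ∈ D, w ≠ x → inner ℝ y x / -inner ℝ z' x < inner ℝ y w / -inner ℝ z' w := by
    intro w hw hwx
    refine lt_of_le_of_ne (hx w hw) fun h => ?_
    obtain ⟨hwS, hwy, hwz⟩ := Finset.mem_filter.1 hw
    have hwx' : w ≠ -x := by
      rintro rfl
      rw [inner_neg_right] at hwy
      linarith
    refine hz'B (inner ℝ y x • w - inner ℝ y w • x) (Finset.mem_image.2 ⟨(x, w), ?_, rfl⟩) ?_
    · simp [hxS, hwS, hwx, hwx']
    · rw [div_eq_div_iff (by linarith) (by linarith)] at h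
      rw [inner_sub_right, real_inner_smul_right, real_inner_smul_right]
      linarith
  -- Stopping just after the first crossing leaves only the wall of `x` crossed.
  have hev : ∀ᶠ τ : ℝ in 𝓝[>] (inner ℝ y x / -inner ℝ z' x), ∀ w ∈ D, w ≠ x →
      τ < inner ℝ y w / -inner ℝ z' w := by
    rw [Filter.eventually_all_finset]
    intro w hw
    by_cases hwx : w = x
    · exact Eventually.of_forall fun _ h => absurd hwx h
    · filter_upwards [nhdsWithin_le_nhds (eventually_lt_nhds (hlt w hw hwx))] with τ hτ _ using hτ
  obtain ⟨τ, hτD, hτ⟩ := (hev.and self_mem_nhdsWithin).exists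
  have hτ' : inner ℝ y x / -inner ℝ z' x < τ := hτ
  have hτ0 : 0 < τ := (div_pos hxy (by linarith)).trans hτ'
  have key : ∀ w ∈ S, w ≠ x → 0 < inner ℝ y w → 0 < inner ℝ (y + τ • z') w := by
    intro w hw hwx hwy
    rw [inner_add_left, real_inner_smul_left]
    rcases lt_or_ge (inner ℝ z' w) 0 with hwz | hwz
    · have := hτD w (Finset.mem_filter.2 ⟨hw, hwy, hwz⟩) hwx
      rw [lt_div_iff₀ (by linarith)] at this
      linarith
    · positivity
  refine ⟨x, y + τ • z', ⟨hxS, hxy, ?_, fun w hw hwx hwx' => ?_⟩, by nlinarith [hz' x hxS]⟩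
  · rw [inner_add_left, real_inner_smul_left]
    rw [div_lt_iff₀ (by linarith)] at hτ'
    linarith
  · rcases (hy w hw).lt_or_gt with h | h
    · have := key (-w) (hS.neg_mem w hw) (fun h => hwx' (by rw [← h, neg_neg]))
        (by rw [inner_neg_right]; linarith)
      rw [inner_neg_right] at this
      exact mul_pos_of_neg_of_neg h (by linarith)
    · exact mul_pos h (key w hw hwx h)

/-- The chambers of the hyperplane arrangement defined by `S` are connected by crossing walls. -/
theorem generic_induction [FiniteDimensional ℝ V] {S : Finset V} (hS : Reduced S) {P : V → Prop}
    (hcongr : ∀ y z, Generic S y → (∀ x ∈ S, 0 < inner ℝ y x * inner ℝ z x) → P y → P z)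
    (hwall : ∀ y y' x, IsWall S y y' x → P y → P y')
    {y z : V} (hy : Generic S y) (hz : Generic S z) (h : P y) : P z := by
  -- The induction is on the number of elements of `S` that separate `y` from `z`; each crossing
  -- towards `z` lowers it.
  induction hn : (S.filter fun x => 0 < inner ℝ y x ∧ inner ℝ z x < 0).card using
    Nat.strong_induction_on generalizing y with
  | _ n ih =>
    by_cases hD : ∃ x₀ ∈ S, 0 < inner ℝ y x₀ ∧ inner ℝ z x₀ < 0
    · obtain ⟨x₀, hx₀, h₁, h₂⟩ := hD
      obtain ⟨x, y', hw, hzx⟩ := exists_isWall hS hy hz hx₀ h₁ h₂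
      refine ih _ ?_ hw.generic_right (hwall y y' x hw h) rfl
      rw [← hn]
      refine Finset.card_lt_card (Finset.ssubset_iff_of_subset ?_ |>.2 ⟨x, ?_, ?_⟩)
      · intro w hwm
        obtain ⟨hwS, hwy, hwz⟩ := Finset.mem_filter.1 hwm
        refine Finset.mem_filter.2 ⟨hwS, ?_, hwz⟩
        have h1 : w ≠ x := by
          rintro rfl
          exact (hwy.trans hw.neg).false
        have h2 : w ≠ -x := by
          rintro rfl
          rw [inner_neg_right] at hwz
          linarith
        exact (pos_iff_pos_of_mul_pos (hw.other w hwS h1 h2)).2 hwy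
      · exact Finset.mem_filter.2 ⟨hw.mem, hw.pos, hzx⟩
      · intro hx
        exact ((Finset.mem_filter.1 hx).2.1.trans hw.neg).false
    · push Not at hD
      have hD' : ∀ x ∈ S, 0 < inner ℝ y x → 0 < inner ℝ z x := fun x hx hxy =>
        lt_of_le_of_ne (hD x hx hxy) (hz x hx).symm
      refine hcongr y z hy (fun x hx => ?_) h
      rcases (hy x hx).lt_or_gt with hxy | hxy
      · have := hD' (-x) (hS.neg_mem x hx) (by rw [inner_neg_right]; linarith)
        rw [inner_neg_right] at this
        exact mul_pos_of_neg_of_neg hxy (by linarith)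
      · exact mul_pos hxy (hD' x hx hxy)

theorem exists_generic [FiniteDimensional ℝ V] {S : Finset V} (hS : Reduced S) :
    ∃ y, Generic S y := by
  obtain ⟨y, -, hy⟩ := exists_mem_orthogonal_generic (⊥ : Submodule ℝ V) S
    fun x hx h => hS.ne_zero hx ((Submodule.mem_bot ℝ).1 h)
  exact ⟨y, hy⟩

/-- Every subsystem cut out of `S` by a subspace is thus a face; lines give edges and planes give
2-faces. -/
theorem exists_orthogonal_iff [FiniteDimensional ℝ V] (S : Finset V) (U : Submodule ℝ V) :
    ∃ y ∈ Uᗮ, ∀ x ∈ S, inner ℝ y x = 0 ↔ x ∈ U := by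
  classical
  obtain ⟨y, hyU, hy⟩ := exists_mem_orthogonal_generic U (S.filter fun x => x ∉ U)
    fun x hx => (Finset.mem_filter.1 hx).2
  refine ⟨y, hyU, fun x hx => ⟨fun h => ?_, fun h => ?_⟩⟩
  · by_contra hxU
    exact hy x (Finset.mem_filter.2 ⟨hx, hxU⟩) h
  · exact Submodule.inner_left_of_mem_orthogonal h hyU

theorem Reduced.eq_or_eq_neg_of_mem_span {S : Finset V} (hS : Reduced S) {x z : V} (hx : x ∈ S)
    (hz : z ∈ S) (h : z ∈ Submodule.span ℝ {x}) : z = x ∨ z = -x := by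
  obtain ⟨t, rfl⟩ := Submodule.mem_span_singleton.1 h
  rcases hS.parallel x hx t hz with rfl | rfl <;> simp

/-- Every element of `S` is the normal vector of a wall of a chamber. -/
theorem exists_isWall_of_mem [FiniteDimensional ℝ V] {S : Finset V} (hS : Reduced S) {x : V}
    (hx : x ∈ S) : ∃ y y', IsWall S y y' x := by
  obtain ⟨y, -, hy⟩ := exists_orthogonal_iff S (Submodule.span ℝ {x})
  have hy0 : inner ℝ y x = 0 := (hy x hx).2 (Submodule.mem_span_singleton_self x)
  have hxx : 0 < inner ℝ x x := real_inner_self_pos.2 (hS.ne_zero hx)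
  obtain ⟨ε, hε, h⟩ := exists_perturb S y x
  obtain ⟨δ, hδ, h'⟩ := exists_perturb S y (-x)
  refine ⟨y + ε • x, y + δ • -x, hx, ?_, ?_, fun z hz h1 h2 => ?_⟩
  · rw [inner_add_left, hy0, zero_add, real_inner_smul_left]
    positivity
  · rw [inner_add_left, hy0, zero_add, real_inner_smul_left, inner_neg_left]
    nlinarith
  · have hyz : inner ℝ y z ≠ 0 := fun h0 =>
      (hS.eq_or_eq_neg_of_mem_span hx hz ((hy z hz).1 h0)).elim h1 h2
    have h3 := mul_pos (h z hz hyz) (h' z hz hyz)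
    have h4 := mul_self_pos.2 hyz
    by_contra h5
    nlinarith

end Arrangement

/-! ### Reflection-closed systems, transitivity and normalization. -/

section Reflections

variable {V : Type*} [NormedAddCommGroup V] [InnerProductSpace ℝ V]

/-- The orthogonal reflection in the hyperplane with normal vector `a`. -/
noncomputable def refl (a : V) : V ≃ₗᵢ[ℝ] V := (Submodule.span ℝ {a})ᗮ.reflection

theorem refl_apply (a x : V) : refl a x = x - (2 * inner ℝ a x / ‖a‖ ^ 2) • a := by
  rw [refl, Submodule.reflection_orthogonal_apply, Submodule.reflection_singleton_apply, neg_sub,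
    two_smul, ← add_smul]
  congr 2
  simp
  ring

theorem refl_self (a : V) : refl a a = -a :=
  Submodule.reflection_orthogonalComplement_singleton_eq_neg a

theorem refl_refl (a x : V) : refl a (refl a x) = x :=
  Submodule.reflection_reflection _ x

theorem inner_refl_left (a x y : V) : inner ℝ (refl a x) y = inner ℝ x (refl a y) := by
  rw [← (refl a).inner_map_map, refl_refl]

/-- `S` is closed under the reflections defined by its elements, that is, it is a root system in the
weak sense. -/
def ReflClosed (S : Finset V) : Prop := ∀ a ∈ S, ∀ x ∈ S, refl a x ∈ S

/-- `S` is closed, up to positive factors, under the reflections defined by its elements. -/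
def ScaledReflClosed (S : Finset V) : Prop :=
  ∀ a ∈ S, ∀ x ∈ S, ∃ μ : ℝ, 0 < μ ∧ μ • refl a x ∈ S

/-- The linear isometries that preserve `S` act transitively on the vectors `vert S y`. -/
def Transitive (S : Finset V) : Prop :=
  ∀ y z, Generic S y → Generic S z →
    ∃ g : V ≃ₗᵢ[ℝ] V, (∀ x ∈ S, g x ∈ S) ∧ g (vert S y) = vert S z

theorem ReflClosed.scaled {S : Finset V} (h : ReflClosed S) : ScaledReflClosed S :=
  fun a ha x hx => ⟨1, one_pos, by rw [one_smul]; exact h a ha x hx⟩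

theorem map_eq_of_mapsTo {S : Finset V} (g : V ≃ₗᵢ[ℝ] V) (h : ∀ x ∈ S, g x ∈ S) :
    S.map g.toEquiv.toEmbedding = S := by
  refine Finset.eq_of_subset_of_card_le (fun x hx => ?_) (by rw [Finset.card_map])
  obtain ⟨z, hz, rfl⟩ := Finset.mem_map.1 hx
  exact h z hz

theorem vert_map (S : Finset V) (g : V ≃ₗᵢ[ℝ] V) (y : V) :
    vert (S.map g.toEquiv.toEmbedding) (g y) = g (vert S y) := by
  rw [vert, vert, Finset.sum_map, map_sum]
  refine Finset.sum_congr rfl fun x _ => ?_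
  have : inner ℝ (g y) (g.toEquiv.toEmbedding x) = inner ℝ y x := g.inner_map_map y x
  rw [this]
  split_ifs
  · rfl
  · rw [map_zero]

theorem vert_apply {S : Finset V} (g : V ≃ₗᵢ[ℝ] V) (h : ∀ x ∈ S, g x ∈ S) (y : V) :
    vert S (g y) = g (vert S y) := by
  rw [← vert_map, map_eq_of_mapsTo g h]

theorem vert_neg {S : Finset V} (hS : Reduced S) (y : V) : vert S (-y) = -vert S y :=
  vert_apply (LinearIsometryEquiv.neg ℝ) hS.neg_mem y

/-- The two ends `v` and `v - 2x` of an edge have equal norms. -/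
theorem IsWall.inner_vert {S : Finset V} {y y' x : V} (h : IsWall S y y' x) (hS : Reduced S)
    (hI : Inscribed S) : inner ℝ (vert S y) x = ‖x‖ ^ 2 := by
  obtain ⟨ρ, hρ⟩ := hI
  have h1 := hρ y' h.generic_right
  rw [h.vert_eq hS, ← hρ y h.generic_left] at h1
  have h2 := norm_sub_sq_real (vert S y) ((2 : ℝ) • x)
  rw [h1, real_inner_smul_right, norm_smul, Real.norm_ofNat] at h2
  linarith

theorem IsWall.refl_vert {S : Finset V} {y y' x : V} (h : IsWall S y y' x) (hS : Reduced S)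
    (hI : Inscribed S) : refl x (vert S y) = vert S y' := by
  rw [refl_apply, real_inner_comm, h.inner_vert hS hI, h.vert_eq hS, mul_div_assoc, div_self,
    mul_one]
  exact pow_ne_zero 2 (hS.norm_pos h.mem).ne'

/-- The reflection takes the chamber of `y` to that of `y'`. For `w ≠ ±x`, the vectors `y` and `y'`
agree in sign on `w` and on its mirror image. These differ by a multiple of `x`, on which `y` and
`y'` disagree, so the signs on `w` and on its image cannot be opposite. -/
theorem IsWall.refl_congr {S : Finset V} {y y' x : V} (h : IsWall S y y' x) (hS : Reduced S)
    (hx : ∀ w ∈ S, ∃ μ : ℝ, 0 < μ ∧ μ • refl x w ∈ S) :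
    ∀ w ∈ S, 0 < inner ℝ (refl x y) w * inner ℝ y' w := by
  intro w hw
  rw [inner_refl_left]
  by_cases h1 : w = x
  · rw [h1, refl_self, inner_neg_right]
    nlinarith [h.pos, h.neg]
  by_cases h2 : w = -x
  · rw [h2, map_neg, refl_self, neg_neg, inner_neg_right]
    nlinarith [h.pos, h.neg]
  obtain ⟨μ, hμ, hμw⟩ := hx w hw
  have hw1 : μ • refl x w ≠ x := fun h' => by
    have h3 : w = -(μ⁻¹ • x) := by
      rw [← refl_refl x w, ← inv_smul_smul₀ hμ.ne' (refl x w), h', map_smul, refl_self, smul_neg]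
    rcases hS.parallel x h.mem (-μ⁻¹) (by rw [neg_smul, ← h3]; exact hw) with h4 | h4 <;>
    rw [← neg_smul, h4] at h3
    · exact h1 (by simpa using h3)
    · exact h2 (by simpa using h3)
  have hw2 : μ • refl x w ≠ -x := fun h' => by
    have h3 : w = μ⁻¹ • x := by
      rw [← refl_refl x w, ← inv_smul_smul₀ hμ.ne' (refl x w), h', map_smul, map_neg, refl_self,
        neg_neg]
    rcases hS.parallel x h.mem μ⁻¹ (by rw [← h3]; exact hw) with h4 | h4 <;> rw [h4] at h3
    · exact h1 (by simpa using h3)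
    · exact h2 (by simpa using h3)
  have h3 := h.other _ hμw hw1 hw2
  have h4 := h.other w hw h1 h2
  rw [real_inner_smul_right, real_inner_smul_right] at h3
  have h5 : 0 < inner ℝ y (refl x w) * inner ℝ y' (refl x w) := by
    by_contra h6
    nlinarith [mul_pos hμ hμ]
  have h6 : (inner ℝ y w - inner ℝ y (refl x w)) * (inner ℝ y' w - inner ℝ y' (refl x w)) ≤ 0 := by
    rw [refl_apply, inner_sub_right, inner_sub_right, real_inner_smul_right, real_inner_smul_right,
      sub_sub_cancel, sub_sub_cancel, mul_mul_mul_comm]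
    exact mul_nonpos_of_nonneg_of_nonpos (mul_self_nonneg _)
      (mul_nonpos_of_nonneg_of_nonpos h.pos.le h.neg.le)
  by_contra h7
  rcases pos_and_pos_or_neg_and_neg_of_mul_pos h4 with ⟨a1, a2⟩ | ⟨a1, a2⟩ <;>
  rcases pos_and_pos_or_neg_and_neg_of_mul_pos h5 with ⟨b1, b2⟩ | ⟨b1, b2⟩ <;>
  nlinarith

theorem ReflClosed.transitive [FiniteDimensional ℝ V] {S : Finset V} (hS : Reduced S)
    (h : ReflClosed S) : Transitive S := by
  intro y z hy hz
  refine generic_induction hS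
    (P := fun z => ∃ g : V ≃ₗᵢ[ℝ] V, (∀ x ∈ S, g x ∈ S) ∧ g (vert S y) = vert S z)
    ?_ ?_ hy hz ⟨LinearIsometryEquiv.refl ℝ V, fun x hx => hx, rfl⟩
  · rintro z z' - hzz' ⟨g, hg, hgz⟩
    exact ⟨g, hg, by rw [hgz, vert_congr hzz']⟩
  · rintro z z' x hw ⟨g, hg, hgz⟩
    refine ⟨g.trans (refl x), fun w hw' => h x hw.mem _ (hg w hw'), ?_⟩
    rw [LinearIsometryEquiv.trans_apply, hgz, ← vert_apply (refl x) (h x hw.mem)]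
    exact vert_congr (hw.refl_congr hS (h.scaled x hw.mem))

theorem Transitive.inscribed [FiniteDimensional ℝ V] {S : Finset V} (hS : Reduced S)
    (h : Transitive S) : Inscribed S := by
  obtain ⟨y, hy⟩ := exists_generic hS
  refine ⟨‖vert S y‖, fun z hz => ?_⟩
  obtain ⟨g, -, hg⟩ := h y z hy hz
  rw [← hg, g.norm_map]

theorem Reduced.smul_eq {S : Finset V} (hS : Reduced S) {x : V} (hx : x ∈ S) {t : ℝ}
    (ht : t • x ∈ S) : t • x = x ∨ t • x = -x := by
  rcases hS.parallel x hx t ht with rfl | rfl <;> simp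

/-- A reflection that permutes the directions in `S` permutes the walls of the chambers. -/
theorem IsWall.map_refl {S : Finset V} (hS : Reduced S) {a : V}
    (ha : ∀ w ∈ S, ∃ μ : ℝ, 0 < μ ∧ μ • refl a w ∈ S) {z z' w : V} (h : IsWall S z z' w) {μ : ℝ}
    (hμ : 0 < μ) (hw : μ • refl a w ∈ S) : IsWall S (refl a z) (refl a z') (μ • refl a w) := by
  refine ⟨hw, ?_, ?_, fun u hu h1 h2 => ?_⟩
  · rw [real_inner_smul_right, (refl a).inner_map_map]
    exact mul_pos hμ h.pos
  · rw [real_inner_smul_right, (refl a).inner_map_map]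
    exact mul_neg_of_pos_of_neg hμ h.neg
  · obtain ⟨ν, hν, hu'⟩ := ha u hu
    have key : ∀ s : ℝ, ν • refl a u ≠ s • w := fun s hs => by
      have h3 : u = (ν⁻¹ * s * μ⁻¹) • μ • refl a w := by
        rw [smul_smul, inv_mul_cancel_right₀ hμ.ne', mul_smul, ← map_smul (refl a) s w, ← hs,
          map_smul, refl_refl, smul_smul, inv_mul_cancel₀ hν.ne', one_smul]
      exact (hS.smul_eq hw (h3 ▸ hu)).elim (fun h => h1 (h3.trans h)) (fun h => h2 (h3.trans h))
    have h3 := h.other _ hu' (by simpa using key 1) (by simpa using key (-1))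
    rw [real_inner_smul_right, real_inner_smul_right] at h3
    rw [inner_refl_left, inner_refl_left]
    by_contra h4
    nlinarith [mul_pos hν hν]

/-- The reflection in `a` permutes the chambers. Walking from a wall of `a` to a wall of `x`, one
checks that it also carries vertices to the corresponding vertices; `IsWall.inner_vert` on both
sides then fixes the scale of each reflected normal. -/
theorem ScaledReflClosed.reflClosed [FiniteDimensional ℝ V] {S : Finset V} (hS : Reduced S)
    (hI : Inscribed S) (h : ScaledReflClosed S) : ReflClosed S := by
  intro a ha x hx
  have step : ∀ z z' w, IsWall S z z' w → refl a (vert S z) = vert S (refl a z) →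
      refl a w ∈ S ∧ refl a (vert S z') = vert S (refl a z') := by
    intro z z' w hw hz
    obtain ⟨μ, hμ, hμw⟩ := h a ha w hw.mem
    have hw' := hw.map_refl hS (h a ha) hμ hμw
    have h1 := hw'.inner_vert hS hI
    rw [← hz, real_inner_smul_right, (refl a).inner_map_map, hw.inner_vert hS hI, norm_smul,
      (refl a).norm_map, Real.norm_of_nonneg hμ.le, mul_pow, sq μ, mul_assoc] at h1
    have h2 : 0 < μ * ‖w‖ ^ 2 := mul_pos hμ (pow_pos (hS.norm_pos hw.mem) 2)
    -- The wall identity at the reflected chamber reads `μ * ‖w‖ ^ 2 = μ ^ 2 * ‖w‖ ^ 2`.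
    have h3 : μ = 1 := by
      have : (μ - 1) * (μ * ‖w‖ ^ 2) = 0 := by linarith
      rcases mul_eq_zero.1 this with h | h
      · linarith
      · exact absurd h h2.ne'
    rw [h3, one_smul] at hw'
    refine ⟨hw'.mem, ?_⟩
    rw [hw.vert_eq hS, hw'.vert_eq hS, map_sub, map_smul, hz]
  obtain ⟨y, y', hy⟩ := exists_isWall_of_mem hS ha
  obtain ⟨z, z', hz⟩ := exists_isWall_of_mem hS hx
  refine (step z z' x hz ?_).1
  refine generic_induction hS (P := fun z => refl a (vert S z) = vert S (refl a z))
    ?_ (fun z z' w hw h' => (step z z' w hw h').2) hy.generic_left hz.generic_left ?_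
  · intro u u' _ huu' hu
    rw [← vert_congr huu', hu]
    refine vert_congr fun w hw => ?_
    obtain ⟨μ, hμ, hμw⟩ := h a ha w hw
    have h3 := huu' _ hμw
    rw [real_inner_smul_right, real_inner_smul_right] at h3
    rw [inner_refl_left, inner_refl_left]
    by_contra h4
    nlinarith [mul_pos hμ hμ]
  · rw [hy.refl_vert hS hI, vert_congr (hy.refl_congr hS (h a ha))]

/-- `vert S y` determines the chamber of `y`. -/
theorem mul_inner_pos_of_vert_eq {S : Finset V} (hS : Reduced S) {y z : V} (hy : Generic S y)
    (h : vert S y = vert S z) : ∀ x ∈ S, 0 < inner ℝ y x * inner ℝ z x := by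
  have h1 : ∑ x ∈ S, inner ℝ y (if 0 < inner ℝ z x then x else 0) =
      ∑ x ∈ S, inner ℝ y (if 0 < inner ℝ y x then x else 0) := by
    rw [← inner_sum, ← inner_sum]
    exact congrArg _ h.symm
  -- `vert S y` maximizes the inner product with `y` term by term, so equal sums force equal terms.
  have h2 := (Finset.sum_eq_sum_iff_of_le (fun x _ => by
    split_ifs with h3 h4 h4
    · exact le_rfl
    · rw [inner_zero_right]
      exact not_lt.1 h4
    · rw [inner_zero_right]
      exact h4.le
    · exact le_rfl)).1 h1
  have key : ∀ x ∈ S, 0 < inner ℝ y x → 0 < inner ℝ z x := by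
    intro x hx hyx
    by_contra h3
    have := h2 x hx
    rw [if_neg h3, if_pos hyx, inner_zero_right] at this
    exact hyx.ne this
  intro x hx
  rcases (hy x hx).lt_or_gt with hxy | hxy
  · have := key (-x) (hS.neg_mem x hx) (by rw [inner_neg_right]; linarith)
    rw [inner_neg_right] at this
    exact mul_pos_of_neg_of_neg hxy (by linarith)
  · exact mul_pos hxy (key x hx hxy)

open scoped Classical in
/-- The unit vectors in the directions of the elements of `S`. -/
noncomputable def unit (S : Finset V) : Finset V := S.image fun x => ‖x‖⁻¹ • x

theorem mem_unit {S : Finset V} {u : V} : u ∈ unit S ↔ ∃ x ∈ S, ‖x‖⁻¹ • x = u := by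
  simp [unit]

theorem norm_eq_one_of_mem_unit {S : Finset V} (hS : Reduced S) {u : V} (hu : u ∈ unit S) :
    ‖u‖ = 1 := by
  obtain ⟨x, hx, rfl⟩ := mem_unit.1 hu
  rw [norm_smul, norm_inv, norm_norm, inv_mul_cancel₀ (hS.norm_pos hx).ne']

theorem Reduced.unit {S : Finset V} (hS : Reduced S) : Reduced (unit S) where
  zero_notMem h := by simpa using norm_eq_one_of_mem_unit hS h
  neg_mem u hu := by
    obtain ⟨x, hx, rfl⟩ := mem_unit.1 hu
    exact mem_unit.2 ⟨-x, hS.neg_mem x hx, by rw [norm_neg, smul_neg]⟩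
  parallel u hu t ht := by
    have h1 := norm_eq_one_of_mem_unit hS hu
    have h2 := norm_eq_one_of_mem_unit hS ht
    rw [norm_smul, h1, mul_one, Real.norm_eq_abs] at h2
    exact eq_or_eq_neg_of_abs_eq h2

theorem inner_unit_pos {S : Finset V} (hS : Reduced S) {x : V} (hx : x ∈ S) (y z : V) :
    0 < inner ℝ y (‖x‖⁻¹ • x) * inner ℝ z (‖x‖⁻¹ • x) ↔ 0 < inner ℝ y x * inner ℝ z x := by
  have h := inv_pos.2 (hS.norm_pos hx)
  rw [real_inner_smul_right, real_inner_smul_right, mul_mul_mul_comm]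
  exact mul_pos_iff_of_pos_left (mul_pos h h)

theorem Generic.of_unit {S : Finset V} {y : V} (h : Generic (unit S) y) : Generic S y := by
  intro x hx h0
  refine h _ (mem_unit.2 ⟨x, hx, rfl⟩) ?_
  rw [real_inner_smul_right, h0, mul_zero]

/-- A symmetry of `S` also preserves the unit vectors. As it moves vertices of `S` transitively and
a vertex determines its chamber, it moves chambers, hence vertices of the unit system, transitively.
-/
theorem Transitive.inscribed_unit [FiniteDimensional ℝ V] {S : Finset V} (hS : Reduced S)
    (h : Transitive S) : Inscribed (unit S) := by
  obtain ⟨y, hy⟩ := exists_generic hS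
  refine ⟨‖vert (unit S) y‖, fun z hz => ?_⟩
  obtain ⟨g, hgS, hg⟩ := h y z hy hz.of_unit
  have hgy : Generic S (g y) := fun x hx => by
    rw [← map_eq_of_mapsTo g hgS] at hx
    obtain ⟨w, hw, rfl⟩ := Finset.mem_map.1 hx
    have : inner ℝ (g y) (g w) = inner ℝ y w := g.inner_map_map y w
    exact this ▸ hy w hw
  rw [← vert_apply g hgS] at hg
  have h1 := mul_inner_pos_of_vert_eq hS hgy hg
  have h2 : vert (unit S) (g y) = vert (unit S) z := vert_congr fun u hu => by
    obtain ⟨x, hx, rfl⟩ := mem_unit.1 hu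
    exact (inner_unit_pos hS hx _ _).2 (h1 x hx)
  rw [← h2, vert_apply g, g.norm_map]
  intro u hu
  obtain ⟨x, hx, rfl⟩ := mem_unit.1 hu
  exact mem_unit.2 ⟨g x, hgS x hx, by rw [g.norm_map, map_smul]⟩

theorem ReflClosed.scaled_of_unit {S : Finset V} (hS : Reduced S) (h : ReflClosed (unit S)) :
    ScaledReflClosed S := by
  intro a ha x hx
  obtain ⟨z, hz, hzx⟩ := mem_unit.1 (h _ (mem_unit.2 ⟨a, ha, rfl⟩) _ (mem_unit.2 ⟨x, hx, rfl⟩))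
  have h1 : refl (‖a‖⁻¹ • a) = refl a := by
    rw [refl, refl]
    congr 2
    exact Submodule.span_singleton_smul_eq (inv_ne_zero (hS.norm_pos ha).ne').isUnit a
  rw [h1, map_smul] at hzx
  refine ⟨‖z‖ * ‖x‖⁻¹, mul_pos (hS.norm_pos hz) (inv_pos.2 (hS.norm_pos hx)), ?_⟩
  rw [mul_smul, ← hzx, smul_smul, mul_inv_cancel₀ (hS.norm_pos hz).ne', one_smul]
  exact hz

end Reflections

/-! ### Faces as subsystems, and the reduction to the plane. -/

section Faces

variable {V : Type*} [NormedAddCommGroup V] [InnerProductSpace ℝ V]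

/-- The elements of `S` that are orthogonal to `y`. -/
noncomputable def face (S : Finset V) (y : V) : Finset V := S.filter fun x => inner ℝ y x = 0

theorem mem_face {S : Finset V} {y x : V} : x ∈ face S y ↔ x ∈ S ∧ inner ℝ y x = 0 :=
  Finset.mem_filter

theorem Reduced.face {S : Finset V} (hS : Reduced S) (y : V) : Reduced (face S y) :=
  hS.filter _ fun x hx => by rw [inner_neg_right, hx, neg_zero]

theorem ReflClosed.face {S : Finset V} (h : ReflClosed S) (y : V) : ReflClosed (face S y) := by
  intro a ha x hx
  rw [mem_face] at ha hx ⊢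
  refine ⟨h a ha.1 x hx.1, ?_⟩
  rw [refl_apply, inner_sub_right, real_inner_smul_right, hx.2, ha.2, mul_zero, sub_zero]

/-- The vertices come in pairs `p ± v`, so the parallelogram law gives `‖v‖ ^ 2 = ρ ^ 2 - ‖p‖ ^ 2`.
Hence the sphere may be centred at the centre of symmetry. -/
theorem inscribed_of_translate {S : Finset V} (hS : Reduced S) {p : V} {ρ : ℝ}
    (h : ∀ y, Generic S y → ‖p + vert S y‖ = ρ) : Inscribed S := by
  refine ⟨√(ρ ^ 2 - ‖p‖ ^ 2), fun y hy => ?_⟩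
  have h1 := norm_add_sq_real p (vert S y)
  have h2 := norm_sub_sq_real p (vert S y)
  rw [h y hy] at h1
  rw [sub_eq_add_neg, ← vert_neg hS, h _ hy.neg] at h2
  rw [eq_comm, Real.sqrt_eq_iff_eq_sq _ (norm_nonneg _)]
  · linarith
  · nlinarith [sq_nonneg ‖vert S y‖]

/-- Pushing `y₀` slightly along `y` keeps the signs off the face and takes those of `y` on it:
vertices of a face are vertices of the whole. -/
theorem exists_vert_eq_add (S : Finset V) (y₀ : V) {y : V} (hy : Generic (face S y₀) y) :
    ∃ Y, Generic S Y ∧ vert S Y = vert S y₀ + vert (face S y₀) y := by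
  obtain ⟨ε, hε, h⟩ := exists_perturb S y₀ y
  refine ⟨y₀ + ε • y, fun x hx => ?_, ?_⟩
  · by_cases h0 : inner ℝ y₀ x = 0
    · rw [inner_add_left, h0, zero_add, real_inner_smul_left]
      exact mul_ne_zero hε.ne' (hy x (mem_face.2 ⟨hx, h0⟩))
    · exact right_ne_zero_of_mul (h x hx h0).ne'
  · rw [vert, vert, vert, face, Finset.sum_filter, ← Finset.sum_add_distrib]
    refine Finset.sum_congr rfl fun x hx => ?_
    by_cases h0 : inner ℝ y₀ x = 0
    · rw [inner_add_left, h0, zero_add, real_inner_smul_left]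
      simp [hε]
    · simp only [pos_iff_pos_of_mul_pos (h x hx h0), h0, if_false, add_zero]

theorem Inscribed.face {S : Finset V} (hS : Reduced S) (h : Inscribed S) (y₀ : V) :
    Inscribed (face S y₀) := by
  obtain ⟨ρ, hρ⟩ := h
  refine inscribed_of_translate (hS.face y₀) (p := vert S y₀) (ρ := ρ) fun y hy => ?_
  obtain ⟨Y, hY, hYv⟩ := exists_vert_eq_add S y₀ hy
  rw [← hYv, hρ Y hY]

theorem finrank_span_pair {a x : V} (ha : a ≠ 0) (hx : x ∉ Submodule.span ℝ {a}) :
    Module.finrank ℝ (Submodule.span ℝ {a, x}) = 2 := by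
  have hli : LinearIndependent ℝ ![a, x] := by
    rw [LinearIndependent.pair_iff' ha]
    exact fun t ht => hx (Submodule.mem_span_singleton.2 ⟨t, ht⟩)
  have := finrank_span_eq_card hli
  rwa [Matrix.range_cons_cons_empty, Fintype.card_fin] at this

/-- Two independent elements of `S` lie in a planar face. -/
theorem exists_face_finrank_two [FiniteDimensional ℝ V] {S : Finset V} {a x : V} (ha : a ∈ S)
    (ha0 : a ≠ 0) (hx : x ∈ S) (hax : x ∉ Submodule.span ℝ {a}) :
    ∃ y, Module.finrank ℝ (Submodule.span ℝ (face S y : Set V)) = 2 ∧ a ∈ face S y ∧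
      x ∈ face S y := by
  obtain ⟨y, -, hy⟩ := exists_orthogonal_iff S (Submodule.span ℝ {a, x})
  have ha' : a ∈ face S y := mem_face.2 ⟨ha, (hy a ha).2 (Submodule.subset_span (by simp))⟩
  have hx' : x ∈ face S y := mem_face.2 ⟨hx, (hy x hx).2 (Submodule.subset_span (by simp))⟩
  suffices hspan : Submodule.span ℝ (face S y : Set V) = Submodule.span ℝ {a, x} from
    ⟨y, by rw [hspan, finrank_span_pair ha0 hax], ha', hx'⟩
  refine le_antisymm (Submodule.span_le.2 fun z hz => ?_) (Submodule.span_mono ?_)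
  · obtain ⟨hz, hz0⟩ := mem_face.1 hz
    exact (hy z hz).1 hz0
  · rintro z (rfl | rfl)
    · exact ha'
    · exact hx'

theorem reflClosed_of_face [FiniteDimensional ℝ V] {S : Finset V} (hS : Reduced S)
    (h : ∀ y, Module.finrank ℝ (Submodule.span ℝ (face S y : Set V)) = 2 →
      ReflClosed (face S y)) : ReflClosed S := by
  intro a ha x hx
  by_cases hax : x ∈ Submodule.span ℝ {a}
  · rcases hS.eq_or_eq_neg_of_mem_span ha hx hax with rfl | rfl
    · rw [refl_self]
      exact hS.neg_mem _ hx
    · rw [map_neg, refl_self, neg_neg]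
      exact ha
  · obtain ⟨y, hy, ha', hx'⟩ := exists_face_finrank_two ha (hS.ne_zero ha) hx hax
    exact (mem_face.1 (h y hy a ha' x hx')).1

theorem vert_mem_span (S : Finset V) (y : V) : vert S y ∈ Submodule.span ℝ (S : Set V) := by
  refine Submodule.sum_mem _ fun x hx => ?_
  split_ifs
  · exact Submodule.subset_span hx
  · exact zero_mem _

/-- In the plane, an equilateral inscribed system is closed under reflections. -/
theorem reflClosed_of_finrank_eq_two [FiniteDimensional ℝ V] {S : Finset V} (hS : Reduced S)
    (hU : Module.finrank ℝ (Submodule.span ℝ (S : Set V)) = 2) (hI : Inscribed S) {ℓ : ℝ}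
    (hℓ : ∀ x ∈ S, ‖x‖ = ℓ) : ReflClosed S := by
  obtain ⟨ρ, hρ⟩ := id hI
  set U := Submodule.span ℝ (S : Set V) with hUdef
  have hdist : ∀ {y y' x}, IsWall S y y' x → dist (vert S y') (vert S y) = 2 * ℓ := by
    intro y y' x h
    rw [h.vert_eq hS, dist_eq_norm, sub_sub_cancel_left, norm_neg, norm_smul, hℓ x h.mem,
      Real.norm_ofNat]
  -- In rank two a chamber has another wall: walking from `y` towards `-y'` crosses some `x₂` with
  -- `0 < ⟪y', x₂⟫`, whereas `⟪y', x⟫ < 0`.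
  have hsecond : ∀ {y y' x}, IsWall S y y' x → ∃ x₂ y₂, IsWall S y y₂ x₂ ∧ x₂ ≠ x := by
    intro y y' x h
    obtain ⟨w, hw, hwx⟩ : ∃ w ∈ S, w ∉ Submodule.span ℝ {x} := by
      by_contra! h'
      have h1 : U ≤ Submodule.span ℝ {x} := Submodule.span_le.2 h'
      have h2 := Submodule.finrank_mono h1
      have h3 := finrank_span_singleton (K := ℝ) (hS.ne_zero h.mem)
      omega
    have hwx₁ : w ≠ x := fun h' => hwx (h' ▸ Submodule.mem_span_singleton_self w)
    have hwx₂ : w ≠ -x := fun h' => hwx (h' ▸ neg_mem (Submodule.mem_span_singleton_self x))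
    obtain ⟨u, hu, hu1, hu2⟩ : ∃ u ∈ S, 0 < inner ℝ y u ∧ 0 < inner ℝ y' u := by
      rcases pos_and_pos_or_neg_and_neg_of_mul_pos (h.other w hw hwx₁ hwx₂) with h' | h'
      · exact ⟨w, hw, h'⟩
      · refine ⟨-w, hS.neg_mem w hw, ?_⟩
        rw [inner_neg_right, inner_neg_right]
        exact ⟨neg_pos.2 h'.1, neg_pos.2 h'.2⟩
    obtain ⟨x₂, y₂, h₂, h₂'⟩ := exists_isWall hS h.generic_left h.generic_right.neg hu hu1
      (by rw [inner_neg_left]; linarith)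
    refine ⟨x₂, y₂, h₂, fun h' => ?_⟩
    rw [h', inner_neg_left] at h₂'
    linarith [h.neg]
  have hfirst : ∀ {y}, Generic S y → S.Nonempty → ∃ x y', IsWall S y y' x := by
    rintro y hy ⟨x, hx⟩
    obtain ⟨u, hu, hu'⟩ : ∃ u ∈ S, 0 < inner ℝ y u := by
      rcases (hy x hx).lt_or_gt with h | h
      · exact ⟨-x, hS.neg_mem x hx, by rw [inner_neg_right]; linarith⟩
      · exact ⟨x, hx, h⟩
    obtain ⟨x, y', h, -⟩ := exists_isWall hS hy hy.neg hu hu' (by rw [inner_neg_left]; linarith)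
    exact ⟨x, y', h⟩
  -- The circle of radius `ρ` about `0` and that of radius `2ℓ` about a vertex meet in at most two
  -- points, already taken by the two neighbouring vertices.
  have hnbr : ∀ {y p}, Generic S y → S.Nonempty → p ∈ U → ‖p‖ = ρ → dist p (vert S y) = 2 * ℓ →
      ∃ y' x, IsWall S y y' x ∧ vert S y' = p := by
    intro y p hy hne hpU hpρ hp
    obtain ⟨x₁, y₁, h₁⟩ := hfirst hy hne
    obtain ⟨x₂, y₂, h₂, h₁₂⟩ := hsecond h₁
    have hmem : ∀ y, vert S y ∈ U.toAffineSubspace := vert_mem_span S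
    have hdir : Module.finrank ℝ U.toAffineSubspace.direction = 2 := by
      rw [Submodule.toAffineSubspace_direction, hU]
    have h0 : (0 : V) ≠ vert S y := fun h0 => by
      have := h₁.inner_vert hS hI
      rw [← h0, inner_zero_left] at this
      exact (pow_pos (hS.norm_pos h₁.mem) 2).ne this
    have h12 : vert S y₁ ≠ vert S y₂ := fun h' => by
      rw [h₁.vert_eq hS, h₂.vert_eq hS, sub_right_inj] at h'
      exact h₁₂ (smul_right_injective V (two_ne_zero (α := ℝ)) h').symm
    rcases EuclideanGeometry.eq_of_dist_eq_of_dist_eq_of_mem_of_finrank_eq_two hdir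
      (zero_mem U) (hmem y) (hmem y₁) (hmem y₂) hpU h0 h12
      ((dist_zero_right _).trans (hρ y₁ h₁.generic_right))
      ((dist_zero_right _).trans (hρ y₂ h₂.generic_right))
      ((dist_zero_right _).trans hpρ) (hdist h₁) (hdist h₂) hp with h | h
    · exact ⟨y₁, x₁, h₁, h.symm⟩
    · exact ⟨y₂, x₂, h₂, h.symm⟩
  intro a ha x hx
  have hne : S.Nonempty := ⟨a, ha⟩
  have hreflU : ∀ p ∈ U, refl a p ∈ U := fun p hp => by
    rw [refl_apply]
    exact sub_mem hp (Submodule.smul_mem _ _ (Submodule.subset_span ha))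
  -- Hence, if a vertex is reflected to a vertex, so are its neighbours; the walk starts at an edge
  -- parallel to `a`, whose ends are exchanged.
  have step : ∀ y y' x, IsWall S y y' x → (∃ z, Generic S z ∧ refl a (vert S y) = vert S z) →
      ∃ z z' x', IsWall S z z' x' ∧ refl a (vert S y) = vert S z ∧
        refl a (vert S y') = vert S z' := by
    rintro y y' x h ⟨z, hz, hyz⟩
    obtain ⟨z', x', h', hp⟩ := hnbr (p := refl a (vert S y')) hz hne
      (hreflU _ (vert_mem_span S y')) (by rw [(refl a).norm_map, hρ y' h.generic_right])
      (by rw [← hyz, (refl a).dist_map, hdist h])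
    exact ⟨z, z', x', h', hyz, hp.symm⟩
  obtain ⟨y₀, y₁, ha'⟩ := exists_isWall_of_mem hS ha
  obtain ⟨y, y', hx'⟩ := exists_isWall_of_mem hS hx
  have hy : ∃ z, Generic S z ∧ refl a (vert S y) = vert S z := by
    refine generic_induction hS (P := fun y => ∃ z, Generic S z ∧ refl a (vert S y) = vert S z)
      ?_ ?_ ha'.generic_left hx'.generic_left
      ⟨y₁, ha'.generic_right, ha'.refl_vert hS hI⟩
    · rintro u u' - huu' ⟨z, hz, h⟩
      exact ⟨z, hz, by rw [← vert_congr huu', h]⟩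
    · rintro u u' w hw h
      obtain ⟨z, z', w', h1, -, h3⟩ := step u u' w hw h
      exact ⟨z', h1.generic_right, h3⟩
  obtain ⟨z, z', x', h1, h2, h3⟩ := step y y' x hx' hy
  -- Comparing the edge vectors `2x` and `2x'` shows that `refl a x = x'`.
  rw [hx'.vert_eq hS, h1.vert_eq hS, map_sub, h2, sub_right_inj, map_smul] at h3
  rw [smul_right_injective V (two_ne_zero (α := ℝ)) h3]
  exact h1.mem

theorem Inscribed.reflClosed [FiniteDimensional ℝ V] {S : Finset V} (hS : Reduced S)
    (hI : Inscribed S) {ℓ : ℝ} (hℓ : ∀ x ∈ S, ‖x‖ = ℓ) : ReflClosed S :=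
  reflClosed_of_face hS fun y hy =>
    reflClosed_of_finrank_eq_two (hS.face y) hy (hI.face hS y) fun x hx => hℓ x (mem_face.1 hx).1

theorem Transitive.reflClosed [FiniteDimensional ℝ V] {S : Finset V} (hS : Reduced S)
    (h : Transitive S) : ReflClosed S := by
  refine ScaledReflClosed.reflClosed hS (h.inscribed hS) (ReflClosed.scaled_of_unit hS ?_)
  exact (h.inscribed_unit hS).reflClosed hS.unit fun u hu => norm_eq_one_of_mem_unit hS hu

end Faces

/-! ### Zonotopes of reduced systems and their faces. -/

section Zono

variable {V : Type*} [NormedAddCommGroup V] [InnerProductSpace ℝ V]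

/-- The Minkowski sum of the segments from `0` to the elements of `S`, translated by `c`. -/
def zono (c : V) (S : Finset V) : Set V :=
  {p | ∃ t : V → ℝ, (∀ x ∈ S, 0 ≤ t x ∧ t x ≤ 1) ∧ p = c + ∑ x ∈ S, t x • x}

theorem center_mem_zono (c : V) (S : Finset V) : c ∈ zono c S :=
  ⟨fun _ => 0, fun _ _ => ⟨le_rfl, zero_le_one⟩, by simp⟩

theorem add_mem_zono {c x : V} {S : Finset V} (hx : x ∈ S) {r : ℝ} (h0 : 0 ≤ r) (h1 : r ≤ 1) :
    c + r • x ∈ zono c S := by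
  classical
  refine ⟨fun z => if z = x then r else 0, fun z _ => ?_, ?_⟩
  · dsimp only
    split_ifs
    · exact ⟨h0, h1⟩
    · exact ⟨le_rfl, zero_le_one⟩
  · simp [ite_smul, hx]

theorem vert_mem_zono (c y : V) (S : Finset V) : c + vert S y ∈ zono c S := by
  refine ⟨fun x => if 0 < inner ℝ y x then 1 else 0, fun x _ => ?_, ?_⟩
  · dsimp only
    split_ifs <;> simp
  · simp [vert, ite_smul]

theorem zono_empty (c : V) : zono c ∅ = {c} := by
  ext p
  simp [zono]

theorem mul_le_ite_pos {t r : ℝ} (h0 : 0 ≤ t) (h1 : t ≤ 1) : t * r ≤ if 0 < r then r else 0 := by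
  split_ifs with h
  · nlinarith
  · nlinarith

theorem inner_vert (S : Finset V) (y : V) :
    inner ℝ y (vert S y) = ∑ x ∈ S, if 0 < inner ℝ y x then inner ℝ y x else 0 := by
  rw [vert, inner_sum]
  refine Finset.sum_congr rfl fun x _ => ?_
  split_ifs <;> simp

theorem inner_le_of_mem_zono {c p : V} {S : Finset V} (hp : p ∈ zono c S) (y : V) :
    inner ℝ y p ≤ inner ℝ y (c + vert S y) := by
  obtain ⟨t, ht, rfl⟩ := hp
  rw [inner_add_right, inner_add_right, inner_vert, inner_sum]
  refine add_le_add_right (Finset.sum_le_sum fun x hx => ?_) _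
  rw [real_inner_smul_right]
  exact mul_le_ite_pos (ht x hx).1 (ht x hx).2

/-- The functional is maximized term by term: coefficients are forced to be 0 or 1 according to
sign, and stay free on the generators orthogonal to `y`. -/
theorem mem_zono_face_iff {c p y : V} {S : Finset V} :
    p ∈ zono (c + vert S y) (face S y) ↔
      p ∈ zono c S ∧ inner ℝ y p = inner ℝ y (c + vert S y) := by
  constructor
  · rintro ⟨t, ht, rfl⟩
    refine ⟨⟨fun x => if inner ℝ y x = 0 then t x else if 0 < inner ℝ y x then 1 else 0,
      fun x hx => ?_, ?_⟩, ?_⟩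
    · dsimp only
      split_ifs with h
      · exact ht x (mem_face.2 ⟨hx, h⟩)
      · simp
      · simp
    · rw [face, Finset.sum_filter, vert, add_assoc, ← Finset.sum_add_distrib]
      congr 1
      refine Finset.sum_congr rfl fun x _ => ?_
      by_cases h : inner ℝ y x = 0
      · simp [h]
      · simp [h, ite_smul]
    · rw [inner_add_right _ _ (∑ _ ∈ _, _), inner_sum, Finset.sum_eq_zero, add_zero]
      intro x hx
      rw [real_inner_smul_right, (mem_face.1 hx).2, mul_zero]
  · rintro ⟨⟨t, ht, rfl⟩, h⟩
    rw [inner_add_right, inner_add_right, inner_vert, inner_sum, add_right_inj] at h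
    have h2 := (Finset.sum_eq_sum_iff_of_le (fun x hx => by
      rw [real_inner_smul_right]
      exact mul_le_ite_pos (ht x hx).1 (ht x hx).2)).1 h
    refine ⟨t, fun x hx => ht x (mem_face.1 hx).1, ?_⟩
    rw [face, Finset.sum_filter, vert, add_assoc, ← Finset.sum_add_distrib]
    congr 1
    refine Finset.sum_congr rfl fun x hx => ?_
    have h3 := h2 x hx
    rw [real_inner_smul_right] at h3
    rcases lt_trichotomy (inner ℝ y x) 0 with h0 | h0 | h0
    · rw [if_neg h0.not_gt, mul_eq_zero, or_iff_left h0.ne] at h3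
      simp [h3, h0.ne, h0.not_gt]
    · simp [h0]
    · rw [if_pos h0, mul_eq_right₀ h0.ne'] at h3
      simp [h3, h0.ne', h0]

theorem vectorSpan_zono (c : V) (S : Finset V) :
    vectorSpan ℝ (zono c S) = Submodule.span ℝ (S : Set V) := by
  apply le_antisymm
  · rw [vectorSpan_def, Submodule.span_le]
    rintro _ ⟨_, ⟨t, -, rfl⟩, _, ⟨s, -, rfl⟩, rfl⟩
    simp only [vsub_eq_sub, add_sub_add_left_eq_sub]
    exact sub_mem
      (Submodule.sum_mem _ fun x hx => Submodule.smul_mem _ _ (Submodule.subset_span hx))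
      (Submodule.sum_mem _ fun x hx => Submodule.smul_mem _ _ (Submodule.subset_span hx))
  · rw [Submodule.span_le]
    intro x hx
    have := vsub_mem_vectorSpan ℝ (add_mem_zono (c := c) hx zero_le_one le_rfl)
      (center_mem_zono c S)
    simpa using this

theorem zono_insert [DecidableEq V] (c : V) {x : V} {S : Finset V} (hx : x ∉ S) :
    zono c (insert x S) = zono c S + (fun r : ℝ => r • x) '' Set.Icc 0 1 := by
  ext p
  rw [Set.mem_add]
  constructor
  · rintro ⟨t, ht, rfl⟩
    refine ⟨_, ⟨t, fun z hz => ht z (Finset.mem_insert_of_mem hz), rfl⟩, _,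
      ⟨t x, ht x (Finset.mem_insert_self x S), rfl⟩, ?_⟩
    rw [Finset.sum_insert hx]
    dsimp only
    abel
  · rintro ⟨_, ⟨t, ht, rfl⟩, _, ⟨r, hr, rfl⟩, rfl⟩
    refine ⟨fun z => if z = x then r else t z, fun z hz => ?_, ?_⟩
    · dsimp only
      split_ifs with h
      · exact hr
      · exact ht z ((Finset.mem_insert.1 hz).resolve_left h)
    · dsimp only
      rw [Finset.sum_insert hx, if_pos rfl, add_comm (r • x), ← add_assoc]
      congr 2
      refine Finset.sum_congr rfl fun z hz => ?_
      rw [if_neg fun h : z = x => hx (h ▸ hz)]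

/-- The segment from `-x` to `x`. -/
def symSegment (x : V) : Set V := (fun r : ℝ => r • x) '' Set.Icc (-1) 1

theorem zono_insert_pair [DecidableEq V] (c : V) {x : V} {S : Finset V} (h0 : x ≠ 0) (hx : x ∉ S)
    (hx' : -x ∉ S) : zono c (insert x (insert (-x) S)) = zono c S + symSegment x := by
  have hne : x ≠ -x := fun h => by
    have h1 := congrArg (fun u => inner ℝ x u) h
    simp only [inner_neg_right] at h1
    linarith [real_inner_self_pos.2 h0]
  rw [zono_insert c (by simp [hne, hx]), zono_insert c hx', add_assoc]
  congr 1
  ext p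
  rw [Set.mem_add]
  constructor
  · rintro ⟨_, ⟨r, hr, rfl⟩, _, ⟨s, hs, rfl⟩, rfl⟩
    refine ⟨s - r, ⟨by linarith [hr.2, hs.1], by linarith [hr.1, hs.2]⟩, ?_⟩
    module
  · rintro ⟨r, hr, rfl⟩
    refine ⟨_, ⟨(1 - r) / 2, ⟨by linarith [hr.2], by linarith [hr.1]⟩, rfl⟩, _,
      ⟨(1 + r) / 2, ⟨by linarith [hr.1], by linarith [hr.2]⟩, rfl⟩, ?_⟩
    module

theorem symSegment_add (x : V) {α : ℝ} (hα : 0 ≤ α) :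
    symSegment x + symSegment (α • x) = symSegment ((1 + α) • x) := by
  ext p
  rw [Set.mem_add]
  constructor
  · rintro ⟨_, ⟨r, hr, rfl⟩, _, ⟨s, hs, rfl⟩, rfl⟩
    have h1 : 0 < 1 + α := by linarith
    refine ⟨(r + s * α) / (1 + α), ⟨?_, ?_⟩, ?_⟩
    · rw [le_div_iff₀ h1]
      nlinarith [hr.1, hs.1]
    · rw [div_le_iff₀ h1]
      nlinarith [hr.2, hs.2]
    · dsimp only
      rw [smul_smul, smul_smul, div_mul_cancel₀ _ h1.ne', add_smul]
  · rintro ⟨r, hr, rfl⟩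
    refine ⟨_, ⟨r, hr, rfl⟩, _, ⟨r, hr, rfl⟩, ?_⟩
    module

theorem segment_eq_symSegment (a b : V) :
    segment ℝ a b = {(1 / 2 : ℝ) • (a + b)} + symSegment ((1 / 2 : ℝ) • (b - a)) := by
  rw [segment_eq_image', Set.singleton_add]
  ext p
  constructor
  · rintro ⟨θ, hθ, rfl⟩
    refine ⟨_, ⟨2 * θ - 1, ⟨by linarith [hθ.1], by linarith [hθ.2]⟩, rfl⟩, ?_⟩
    module
  · rintro ⟨_, ⟨r, hr, rfl⟩, rfl⟩
    refine ⟨(1 + r) / 2, ⟨by linarith [hr.1], by linarith [hr.2]⟩, ?_⟩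
    module

theorem singleton_add_zono (m c : V) (S : Finset V) : {m} + zono c S = zono (m + c) S := by
  rw [Set.singleton_add]
  ext p
  constructor
  · rintro ⟨_, ⟨t, ht, rfl⟩, rfl⟩
    exact ⟨t, ht, by simp only [add_assoc]⟩
  · rintro ⟨t, ht, rfl⟩
    exact ⟨_, ⟨t, ht, rfl⟩, by simp only [add_assoc]⟩

theorem Reduced.insert_pair [DecidableEq V] {S : Finset V} (hS : Reduced S) {x : V} (h0 : x ≠ 0)
    (hx : ∀ z ∈ S, z ∉ Submodule.span ℝ {x}) : Reduced (insert x (insert (-x) S)) where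
  zero_notMem h := by
    simp only [Finset.mem_insert] at h
    rcases h with h | h | h
    · exact h0 h.symm
    · exact h0 (neg_eq_zero.1 h.symm)
    · exact hS.zero_notMem h
  neg_mem z hz := by
    simp only [Finset.mem_insert] at hz ⊢
    rcases hz with rfl | rfl | h
    · simp
    · simp
    · exact Or.inr (Or.inr (hS.neg_mem z h))
  parallel z hz t ht := by
    have key : ∀ s : ℝ, s • x = x → s = 1 := fun s hs => by
      have : (s - 1) • x = 0 := by rw [sub_smul, hs, one_smul, sub_self]
      linarith [(smul_eq_zero.1 this).resolve_right h0]
    have key' : ∀ s : ℝ, s • x = -x → s = -1 := fun s hs => by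
      linarith [key (-s) (by rw [neg_smul, hs, neg_neg])]
    have hmem : ∀ s : ℝ, s • x ∈ Submodule.span ℝ {x} := fun s =>
      Submodule.smul_mem _ _ (Submodule.mem_span_singleton_self x)
    simp only [Finset.mem_insert] at hz ht
    rcases hz with rfl | rfl | hz
    · rcases ht with h | h | h
      · exact Or.inl (key t h)
      · exact Or.inr (key' t h)
      · exact absurd (hmem t) (hx _ h)
    · rw [smul_neg, ← neg_smul] at ht
      rcases ht with h | h | h
      · exact Or.inr (by linarith [key _ h])
      · exact Or.inl (by linarith [key' _ h])
      · exact absurd (hmem _) (hx _ h)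
    · have hback : ∀ s : ℝ, t • z = s • x → s ≠ 0 → False := fun s hs hs0 => by
        have ht0 : t ≠ 0 := by
          rintro rfl
          rw [zero_smul, eq_comm, smul_eq_zero] at hs
          exact hs.elim hs0 h0
        refine hx z hz ?_
        rw [← inv_smul_smul₀ ht0 z, hs]
        exact Submodule.smul_mem _ _ (hmem s)
      rcases ht with h | h | h
      · exact (hback 1 (by rw [h, one_smul]) one_ne_zero).elim
      · exact (hback (-1) (by rw [h, neg_smul, one_smul]) (by norm_num)).elim
      · exact hS.parallel z hz t h

theorem exists_zono_add_symSegment (c w : V) {S : Finset V} (hS : Reduced S) :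
    ∃ S' : Finset V, Reduced S' ∧ zono c S + symSegment w = zono c S' := by
  classical
  by_cases hw : w = 0
  · refine ⟨S, hS, ?_⟩
    have : symSegment w = {0} := by
      rw [hw]
      ext p
      simp only [symSegment, smul_zero, Set.mem_image, Set.mem_singleton_iff]
      exact ⟨fun ⟨_, _, h⟩ => h.symm, fun h => ⟨0, by norm_num, h.symm⟩⟩
    rw [this, Set.add_singleton]
    simp
  by_cases h : ∃ x ∈ S, w ∈ Submodule.span ℝ {x}
  · obtain ⟨x, hx, α, hα, hwx⟩ : ∃ x ∈ S, ∃ α : ℝ, 0 ≤ α ∧ w = α • x := by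
      obtain ⟨x, hx, h⟩ := h
      obtain ⟨α, rfl⟩ := Submodule.mem_span_singleton.1 h
      rcases le_total 0 α with h | h
      · exact ⟨x, hx, α, h, rfl⟩
      · exact ⟨-x, hS.neg_mem x hx, -α, by linarith, by simp⟩
    have hx0 := hS.ne_zero hx
    -- A segment parallel to `x` is absorbed by lengthening the pair `±x` to `±(1 + α) • x`.
    set S₀ := S.filter fun z => z ∉ Submodule.span ℝ {x}
    have hS₀ : Reduced S₀ := hS.filter _ fun z hz => by rwa [neg_mem_iff]
    have hxS₀ : ∀ z ∈ S₀, z ∉ Submodule.span ℝ {x} := fun z hz => (Finset.mem_filter.1 hz).2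
    have hSeq : S = insert x (insert (-x) S₀) := by
      ext z
      simp only [Finset.mem_insert, S₀, Finset.mem_filter]
      constructor
      · intro hz
        by_cases h : z ∈ Submodule.span ℝ {x}
        · rcases hS.eq_or_eq_neg_of_mem_span hx hz h with h | h <;> simp [h]
        · exact Or.inr (Or.inr ⟨hz, h⟩)
      · rintro (rfl | rfl | h)
        · exact hx
        · exact hS.neg_mem _ hx
        · exact h.1
    have hspan : Submodule.span ℝ {(1 + α) • x} = Submodule.span ℝ {x} :=
      Submodule.span_singleton_smul_eq (by linarith : (1 + α) ≠ 0).isUnit x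
    have h1 : ∀ u ∈ Submodule.span ℝ {x}, u ∉ S₀ := fun u hu hu' => hxS₀ u hu' hu
    have hxm := Submodule.mem_span_singleton_self (R := ℝ) x
    have hx1 : (1 + α) • x ≠ 0 := smul_ne_zero (by linarith) hx0
    refine ⟨insert ((1 + α) • x) (insert (-((1 + α) • x)) S₀),
      hS₀.insert_pair hx1 (by rwa [hspan]), ?_⟩
    rw [zono_insert_pair c hx1 (h1 _ (Submodule.smul_mem _ _ hxm))
      (h1 _ (neg_mem (Submodule.smul_mem _ _ hxm))), hSeq,
      zono_insert_pair c hx0 (h1 _ hxm) (h1 _ (neg_mem hxm)), add_assoc, hwx, symSegment_add x hα]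
  · push Not at h
    have h1 : ∀ z ∈ S, z ∉ Submodule.span ℝ {w} := by
      intro z hz hzw
      obtain ⟨t, rfl⟩ := Submodule.mem_span_singleton.1 hzw
      refine h _ hz (Submodule.mem_span_singleton.2 ⟨t⁻¹, inv_smul_smul₀ ?_ w⟩)
      rintro rfl
      exact hS.ne_zero hz (zero_smul ℝ w)
    have hm := Submodule.mem_span_singleton_self (R := ℝ) w
    exact ⟨_, hS.insert_pair hw h1, (zono_insert_pair c hw (fun h => h1 _ h hm)
      (fun h => h1 _ h (neg_mem hm))).symm⟩

theorem exists_zono_sum_segment {ι : Type*} (s : Finset ι) (a b : ι → V) :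
    ∃ (c : V) (S : Finset V), Reduced S ∧ ∑ i ∈ s, segment ℝ (a i) (b i) = zono c S := by
  classical
  induction s using Finset.induction_on with
  | empty =>
    refine ⟨0, ∅, ⟨by simp, by simp, by simp⟩, ?_⟩
    rw [zono_empty, Finset.sum_empty]
    rfl
  | insert i s hi ih =>
    obtain ⟨c, S, hS, h⟩ := ih
    obtain ⟨S', hS', h'⟩ := exists_zono_add_symSegment
      ((1 / 2 : ℝ) • (a i + b i) + c) ((1 / 2 : ℝ) • (b i - a i)) hS
    refine ⟨(1 / 2 : ℝ) • (a i + b i) + c, S', hS', ?_⟩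
    rw [Finset.sum_insert hi, h, segment_eq_symSegment, ← h', ← singleton_add_zono,
      add_right_comm]

/-- The diameter of the segment spanned by a reduced system of rank one. -/
theorem diam_zono_of_span_singleton {S : Finset V} (hS : Reduced S) (c : V) {x : V} (hx : x ∈ S)
    (h : (S : Set V) ⊆ Submodule.span ℝ {x}) : Metric.diam (zono c S) = 2 * ‖x‖ := by
  classical
  have hSeq : S = insert x (insert (-x) ∅) := by
    ext z
    simp only [insert_empty_eq, Finset.mem_insert, Finset.mem_singleton]
    refine ⟨fun hz => hS.eq_or_eq_neg_of_mem_span hx hz (h hz), ?_⟩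
    rintro (rfl | rfl)
    · exact hx
    · exact hS.neg_mem _ hx
  have hZ : zono c S = {c} + symSegment x := by
    rw [hSeq, zono_insert_pair c (hS.ne_zero hx) (by simp) (by simp), zono_empty]
  rw [hZ, Set.singleton_add]
  have hle : ∀ p ∈ (fun q => c + q) '' symSegment x, ∀ q ∈ (fun q => c + q) '' symSegment x,
      dist p q ≤ 2 * ‖x‖ := by
    rintro _ ⟨_, ⟨r, hr, rfl⟩, rfl⟩ _ ⟨_, ⟨s, hs, rfl⟩, rfl⟩
    rw [dist_add_left, dist_eq_norm, ← sub_smul, norm_smul, Real.norm_eq_abs]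
    refine mul_le_mul_of_nonneg_right (abs_le.2 ⟨?_, ?_⟩) (norm_nonneg x)
    · linarith [hr.1, hs.2]
    · linarith [hr.2, hs.1]
  refine le_antisymm (Metric.diam_le_of_forall_dist_le (by positivity) hle) ?_
  have := Metric.dist_le_diam_of_mem (Metric.isBounded_iff.2 ⟨_, fun p hp q hq => hle p hp q hq⟩)
    (Set.mem_image_of_mem (fun q => c + q) (⟨1, by norm_num, rfl⟩ : (1 : ℝ) • x ∈ symSegment x))
    (Set.mem_image_of_mem (fun q => c + q) (⟨-1, by norm_num, rfl⟩ : (-1 : ℝ) • x ∈ symSegment x))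
  rwa [dist_add_left, dist_eq_norm, ← sub_smul, norm_smul, Real.norm_eq_abs,
    show |(1 : ℝ) - -1| = 2 by norm_num] at this

end Zono

/-! ### The zonotope determines its generators and centre. -/

section ZonotopeFaces

variable {V : Type*} [NormedAddCommGroup V] [InnerProductSpace ℝ V]

theorem image_zono {f : V → V} {g : V ≃ₗᵢ[ℝ] V} {c : V} (hf : ∀ v, f (c + v) = f c + g v)
    (S : Finset V) : f '' zono c S = zono (f c) (S.map g.toEquiv.toEmbedding) := by
  ext p
  constructor
  · rintro ⟨_, ⟨t, ht, rfl⟩, rfl⟩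
    refine ⟨fun x => t (g.symm x), fun x hx => ?_, ?_⟩
    · obtain ⟨z, hz, rfl⟩ := Finset.mem_map.1 hx
      change 0 ≤ t (g.symm (g z)) ∧ t (g.symm (g z)) ≤ 1
      rw [g.symm_apply_apply]
      exact ht z hz
    · rw [hf, map_sum, Finset.sum_map]
      congr 1
      refine Finset.sum_congr rfl fun x _ => ?_
      change g (t x • x) = t (g.symm (g x)) • g x
      rw [g.symm_apply_apply, map_smul]
  · rintro ⟨t, ht, rfl⟩
    refine ⟨_, ⟨fun x => t (g x), fun x hx => ht _ (Finset.mem_map_of_mem _ hx), rfl⟩, ?_⟩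
    rw [hf, map_sum, Finset.sum_map]
    congr 1
    refine Finset.sum_congr rfl fun x _ => ?_
    change g (t (g x) • x) = t (g x) • g x
    rw [map_smul]

theorem Reduced.map {S : Finset V} (hS : Reduced S) (g : V ≃ₗᵢ[ℝ] V) :
    Reduced (S.map g.toEquiv.toEmbedding) := by
  have hmem : ∀ x, g x ∈ S.map g.toEquiv.toEmbedding ↔ x ∈ S := fun x =>
    Finset.mem_map' g.toEquiv.toEmbedding
  refine ⟨fun h => ?_, fun x hx => ?_, fun x hx t ht => ?_⟩
  · rw [← map_zero g, hmem] at h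
    exact hS.zero_notMem h
  · obtain ⟨x, rfl⟩ := g.surjective x
    rw [← map_neg, hmem]
    exact hS.neg_mem x ((hmem x).1 hx)
  · obtain ⟨x, rfl⟩ := g.surjective x
    rw [← map_smul, hmem] at ht
    exact hS.parallel x ((hmem x).1 hx) t ht

theorem inner_vert_eq_of_zono_eq {c c' : V} {S S' : Finset V} (h : zono c S = zono c' S') (y : V) :
    inner ℝ y (c + vert S y) = inner ℝ y (c' + vert S' y) :=
  le_antisymm (inner_le_of_mem_zono (h ▸ vert_mem_zono c y S) y)
    (inner_le_of_mem_zono (h ▸ vert_mem_zono c' y S') y)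

theorem zono_face_eq_of_zono_eq {c c' : V} {S S' : Finset V} (h : zono c S = zono c' S') (y : V) :
    zono (c + vert S y) (face S y) = zono (c' + vert S' y) (face S' y) := by
  ext p
  rw [mem_zono_face_iff, mem_zono_face_iff, h, inner_vert_eq_of_zono_eq h]

theorem center_eq_of_zono_eq {c c' : V} {S : Finset V} (h : zono c S = zono c' S) : c = c' := by
  have := inner_vert_eq_of_zono_eq h (c - c')
  rw [inner_add_right, inner_add_right, add_left_inj, ← sub_eq_zero, ← inner_sub_right,
    inner_self_eq_zero] at this
  exact sub_eq_zero.1 this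

theorem exists_face_eq_line [FiniteDimensional ℝ V] {S : Finset V} {x : V} (hx : x ∈ S) :
    ∃ y, x ∈ face S y ∧ (face S y : Set V) ⊆ Submodule.span ℝ {x} ∧
      Submodule.span ℝ (face S y : Set V) = Submodule.span ℝ {x} := by
  obtain ⟨y, -, hy⟩ := exists_orthogonal_iff S (Submodule.span ℝ {x})
  have h1 : x ∈ face S y := mem_face.2 ⟨hx, (hy x hx).2 (Submodule.mem_span_singleton_self x)⟩
  have h2 : (face S y : Set V) ⊆ Submodule.span ℝ {x} := fun z hz =>
    (hy z (mem_face.1 hz).1).1 (mem_face.1 hz).2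
  exact ⟨y, h1, h2, le_antisymm (Submodule.span_le.2 h2)
    (Submodule.span_mono (Set.singleton_subset_iff.2 h1))⟩

/-- A generator can be read off the set: some edge is parallel to `x`, and its length `2 * ‖x‖`
determines `x` up to sign. -/
theorem subset_of_zono_eq [FiniteDimensional ℝ V] {c c' : V} {S S' : Finset V} (hS : Reduced S)
    (hS' : Reduced S') (h : zono c S = zono c' S') : S ⊆ S' := by
  intro x hx
  obtain ⟨y, hxy, hline, hspan⟩ := exists_face_eq_line hx
  have hF := zono_face_eq_of_zono_eq h y
  have hspan' := vectorSpan_zono (c + vert S y) (face S y)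
  rw [hF, vectorSpan_zono, hspan] at hspan'
  obtain ⟨x', hx'⟩ : (face S' y).Nonempty := by
    by_contra h0
    rw [Finset.not_nonempty_iff_eq_empty.1 h0, Finset.coe_empty, Submodule.span_empty, eq_comm,
      Submodule.span_singleton_eq_bot] at hspan'
    exact hS.ne_zero hx hspan'
  have hx'x : x' ∈ Submodule.span ℝ {x} := hspan' ▸ Submodule.subset_span hx'
  obtain ⟨t, rfl⟩ := Submodule.mem_span_singleton.1 hx'x
  have ht0 : t ≠ 0 := by
    rintro rfl
    exact (hS'.face y).ne_zero hx' (zero_smul ℝ x)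
  have hline' : (face S' y : Set V) ⊆ Submodule.span ℝ {t • x} := by
    rw [Submodule.span_singleton_smul_eq ht0.isUnit, ← hspan']
    exact Submodule.subset_span
  have h1 := diam_zono_of_span_singleton (hS.face y) (c + vert S y) hxy hline
  rw [hF, diam_zono_of_span_singleton (hS'.face y) _ hx' hline', norm_smul] at h1
  have h2 : |t| = 1 := by
    have : (‖t‖ - 1) * ‖x‖ = 0 := by linarith
    rcases mul_eq_zero.1 this with h | h
    · rw [Real.norm_eq_abs] at h
      linarith
    · exact absurd h (hS.norm_pos hx).ne'
  have hx'' := (mem_face.1 hx').1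
  rcases eq_or_eq_neg_of_abs_eq h2 with rfl | rfl
  · simpa using hx''
  · simpa using hS'.neg_mem _ hx''

end ZonotopeFaces

/-! ### Translation of the geometric notions into properties of `S`. -/

section Euclidean

variable {d : ℕ} {c : EuclideanSpace ℝ (Fin d)} {S : Finset (EuclideanSpace ℝ (Fin d))}

theorem isFace_zono_iff {F : Set (EuclideanSpace ℝ (Fin d))} :
    IsFace (zono c S) F ↔ ∃ y, F = zono (c + vert S y) (face S y) := by
  have key : ∀ y : EuclideanSpace ℝ (Fin d),
      zono (c + vert S y) (face S y) =
        {x ∈ zono c S | ∀ z ∈ zono c S, inner ℝ y z ≤ inner ℝ y x} := by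
    intro y
    ext p
    rw [mem_zono_face_iff]
    refine and_congr_right fun hp => ⟨fun h z hz => h ▸ inner_le_of_mem_zono hz y, fun h => ?_⟩
    exact le_antisymm (inner_le_of_mem_zono hp y) (h _ (vert_mem_zono c y S))
  constructor
  · rintro ⟨hF, h⟩
    obtain ⟨l, hl⟩ := h hF
    refine ⟨(InnerProductSpace.toDual ℝ _).symm l, ?_⟩
    rw [key, hl]
    simp only [InnerProductSpace.toDual_symm_apply]
  · rintro ⟨y, rfl⟩
    refine ⟨⟨_, center_mem_zono _ _⟩, fun _ => ⟨InnerProductSpace.toDual ℝ _ y, ?_⟩⟩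
    rw [key]
    simp only [InnerProductSpace.toDual_apply_apply]

theorem isFaceOfDim_zono_iff {k : ℕ} {F : Set (EuclideanSpace ℝ (Fin d))} :
    IsFaceOfDim k (zono c S) F ↔ ∃ y,
      Module.finrank ℝ (Submodule.span ℝ (face S y : Set (EuclideanSpace ℝ (Fin d)))) = k ∧
        F = zono (c + vert S y) (face S y) := by
  rw [IsFaceOfDim, isFace_zono_iff]
  constructor
  · rintro ⟨⟨y, rfl⟩, h⟩
    rw [vectorSpan_zono] at h
    exact ⟨y, h, rfl⟩
  · rintro ⟨y, h, rfl⟩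
    rw [vectorSpan_zono]
    exact ⟨⟨y, rfl⟩, h⟩

theorem mem_vertices_zono_iff (hS : Reduced S) {v : EuclideanSpace ℝ (Fin d)} :
    v ∈ vertices (zono c S) ↔ ∃ y, Generic S y ∧ v = c + vert S y := by
  change IsFace (zono c S) {v} ↔ _
  rw [isFace_zono_iff]
  refine exists_congr fun y => ⟨fun h => ?_, ?_⟩
  · refine ⟨fun x hx h0 => ?_, ?_⟩
    · have h1 : c + vert S y ∈ ({v} : Set _) := h ▸ center_mem_zono _ _
      have h2 : c + vert S y + (1 : ℝ) • x ∈ ({v} : Set _) :=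
        h ▸ add_mem_zono (mem_face.2 ⟨hx, h0⟩) zero_le_one le_rfl
      rw [Set.mem_singleton_iff] at h1 h2
      rw [h1, one_smul, add_eq_left] at h2
      exact hS.ne_zero hx h2
    · exact (Set.mem_singleton_iff.1 (h ▸ center_mem_zono _ _ : c + vert S y ∈ ({v} : Set _))).symm
  · rintro ⟨hy, rfl⟩
    have : face S y = ∅ := Finset.filter_eq_empty_iff.2 fun x hx => hy x hx
    rw [this, zono_empty]

theorem vertexTransitive_zono_iff (hS : Reduced S) :
    VertexTransitive (zono c S) ↔ Transitive S := by
  constructor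
  · intro h y z hy hz
    obtain ⟨T, hT, hTy⟩ := h _ ((mem_vertices_zono_iff hS).2 ⟨y, hy, rfl⟩) _
      ((mem_vertices_zono_iff hS).2 ⟨z, hz, rfl⟩)
    set g := T.linearIsometryEquiv
    have hTg : ∀ v, T (c + v) = T c + g v := fun v => by
      have := T.map_vadd c v
      rwa [vadd_eq_add, vadd_eq_add, add_comm, add_comm _ (T c)] at this
    rw [image_zono hTg] at hT
    -- Uniqueness of the generators makes the linear part of `T` preserve `S`; then `T` fixes the
    -- centre `c`.
    have hgS : S.map g.toEquiv.toEmbedding = S :=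
      (subset_of_zono_eq (hS.map g) hS hT).antisymm (subset_of_zono_eq hS (hS.map g) hT.symm)
    rw [hgS] at hT
    refine ⟨g, fun x hx => ?_, ?_⟩
    · have := Finset.mem_map_of_mem g.toEquiv.toEmbedding hx
      rwa [hgS] at this
    · rwa [hTg, center_eq_of_zono_eq hT, add_right_inj] at hTy
  · intro h v hv w hw
    obtain ⟨y, hy, rfl⟩ := (mem_vertices_zono_iff hS).1 hv
    obtain ⟨z, hz, rfl⟩ := (mem_vertices_zono_iff hS).1 hw
    obtain ⟨g, hgS, hg⟩ := h y z hy hz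
    let T := (AffineIsometryEquiv.vaddConst ℝ c).symm.trans
      (g.toAffineIsometryEquiv.trans (AffineIsometryEquiv.vaddConst ℝ c))
    have hT : ∀ p, T p = g (p - c) + c := fun p => rfl
    have hTc : T c = c := by rw [hT, sub_self, map_zero, zero_add]
    have hTg : ∀ v, T (c + v) = T c + g v := fun v => by
      rw [hTc, hT, add_sub_cancel_left, add_comm]
    refine ⟨T, ?_, ?_⟩
    · rw [image_zono hTg, hTc, map_eq_of_mapsTo g hgS]
    · rw [hTg, hTc, hg]

theorem homogeneous_zono_iff (hS : Reduced S) :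
    Homogeneous (zono c S) ↔ Inscribed S ∧ ∃ ℓ : ℝ, ∀ x ∈ S, ‖x‖ = ℓ := by
  constructor
  · rintro ⟨⟨c', ρ, hρ⟩, ℓ, hℓ⟩
    refine ⟨inscribed_of_translate hS (p := c - c') (ρ := ρ) fun y hy => ?_, ℓ / 2, fun x hx => ?_⟩
    · have := hρ ((mem_vertices_zono_iff hS).2 ⟨y, hy, rfl⟩)
      rw [mem_sphere_iff_norm] at this
      rw [← this]
      congr 1
      abel
    · obtain ⟨y, hxy, hline, hspan⟩ := exists_face_eq_line hx
      have := hℓ _ (isFaceOfDim_zono_iff.2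
        ⟨y, by rw [hspan, finrank_span_singleton (hS.ne_zero hx)], rfl⟩)
      rw [diam_zono_of_span_singleton (hS.face y) _ hxy hline] at this
      linarith
  · rintro ⟨⟨ρ, hρ⟩, ℓ, hℓ⟩
    refine ⟨⟨c, ρ, fun v hv => ?_⟩, 2 * ℓ, fun e he => ?_⟩
    · obtain ⟨y, hy, rfl⟩ := (mem_vertices_zono_iff hS).1 hv
      rw [mem_sphere_iff_norm, add_sub_cancel_left, hρ y hy]
    · obtain ⟨y, hy, rfl⟩ := isFaceOfDim_zono_iff.1 he
      obtain ⟨x, hx⟩ : (face S y).Nonempty := by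
        by_contra h0
        rw [Finset.not_nonempty_iff_eq_empty.1 h0, Finset.coe_empty, Submodule.span_empty,
          finrank_bot] at hy
        exact zero_ne_one hy
      have hle : Submodule.span ℝ {x} ≤ Submodule.span ℝ (face S y : Set _) :=
        Submodule.span_mono (Set.singleton_subset_iff.2 hx)
      have heq := Submodule.eq_of_le_of_finrank_eq hle
        (by rw [hy, finrank_span_singleton ((hS.face y).ne_zero hx)])
      rw [diam_zono_of_span_singleton (hS.face y) _ hx (by rw [heq]; exact Submodule.subset_span),
        hℓ x (mem_face.1 hx).1]

/-- Any two independent generators are parallel to edges of a common 2-face. -/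
theorem exists_norm_eq_of_homogeneous_face (hS : Reduced S)
    (h : ∀ F, IsFaceOfDim 2 (zono c S) F → Homogeneous F) : ∃ ℓ : ℝ, ∀ x ∈ S, ‖x‖ = ℓ := by
  rcases S.eq_empty_or_nonempty with rfl | ⟨a, ha⟩
  · exact ⟨0, by simp⟩
  refine ⟨‖a‖, fun x hx => ?_⟩
  by_cases hax : x ∈ Submodule.span ℝ {a}
  · rcases hS.eq_or_eq_neg_of_mem_span ha hx hax with rfl | rfl
    · rfl
    · rw [norm_neg]
  · obtain ⟨y, hy, ha', hx'⟩ := exists_face_finrank_two ha (hS.ne_zero ha) hx hax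
    obtain ⟨-, ℓ, hℓ⟩ := (homogeneous_zono_iff (hS.face y)).1
      (h _ (isFaceOfDim_zono_iff.2 ⟨y, hy, rfl⟩))
    rw [hℓ x hx', hℓ a ha']

end Euclidean

end Zonotopes

theorem mainTheorem7 (d : ℕ) (Z : Set (EuclideanSpace ℝ (Fin d))) (hZ : Zonotopes.IsZonotope Z) :
    (Zonotopes.VertexTransitive Z → ∀ F, Zonotopes.IsFace Z F → Zonotopes.VertexTransitive F) ∧
    (Zonotopes.Homogeneous Z → Zonotopes.VertexTransitive Z) ∧
    ((∀ F, Zonotopes.IsFaceOfDim 2 Z F → Zonotopes.Homogeneous F) → Zonotopes.Homogeneous Z) ∧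
    ((∀ F, Zonotopes.IsFaceOfDim 2 Z F → Zonotopes.VertexTransitive F) →
      Zonotopes.VertexTransitive Z) := by
  open Zonotopes in
  obtain ⟨n, a, b, rfl⟩ := hZ
  obtain ⟨c, S, hS, hZ⟩ := exists_zono_sum_segment Finset.univ a b
  rw [hZ]
  refine ⟨fun h F hF => ?_, fun h => ?_, fun h => ?_, fun h => ?_⟩
  · obtain ⟨y, rfl⟩ := isFace_zono_iff.1 hF
    rw [vertexTransitive_zono_iff hS] at h
    rw [vertexTransitive_zono_iff (hS.face y)]
    exact ((h.reflClosed hS).face y).transitive (hS.face y)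
  · obtain ⟨hI, ℓ, hℓ⟩ := (homogeneous_zono_iff hS).1 h
    exact (vertexTransitive_zono_iff hS).2 ((hI.reflClosed hS hℓ).transitive hS)
  · have hR : ReflClosed S := reflClosed_of_face hS fun y hy => by
      obtain ⟨hI, ℓ, hℓ⟩ := (homogeneous_zono_iff (hS.face y)).1
        (h _ (isFaceOfDim_zono_iff.2 ⟨y, hy, rfl⟩))
      exact hI.reflClosed (hS.face y) hℓ
    exact (homogeneous_zono_iff hS).2
      ⟨(hR.transitive hS).inscribed hS, exists_norm_eq_of_homogeneous_face hS h⟩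
  · refine (vertexTransitive_zono_iff hS).2 (ReflClosed.transitive hS ?_)
    refine reflClosed_of_face hS fun y hy => Transitive.reflClosed (hS.face y) ?_
    exact (vertexTransitive_zono_iff (hS.face y)).1
      (h _ (isFaceOfDim_zono_iff.2 ⟨y, hy, rfl⟩))
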